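/- Let $(W,S)$ be a Coxeter system with length function $\ell$. For $I\subseteq S$ let $W_I$ be the subgroup generated by $I$; call $I$ finitary if $W_I$ is finite, and then let $w_I$ be its longest element. For finitary $I,J$, an $(I,J)$-coset is an element $p$ of $W_I\backslash W/W_J$; write $\overline p$ and $\underline p$ for its maximal and minimal elements in the Bruhat order of $W$. The Bruhat order on $(I,J)$-cosets is defined by $p\le q$ iff $\underline p\le\underline q$ in $W$, and $p<q$ means $p\le q$ and $p\neq q$. Let $*$ be the product of the Coxeter monoid (the Demazure product) on $W$, i.e. the associative product with unit $1$ such that, for $w \in W$ and $s\in S$, $w*s=ws$ if $\ell(ws)>\ell(w)$ and $w*s=w$ otherwise. For an $(I,J)$-coset $p$ and a $(J,K)$-coset $q$, let $p*q$ be the $(I,K)$-coset with $\overline{p*q}=\overline p*\overline q$. An expression is a sequence of finitary subsets $[[I_0\subseteq K_1\supseteq I_1\subseteq\cdots\subseteq K_m\supseteq I_m]]$, $m\ge 0$. It expresses the $(I_0,I_m)$-coset $p$ with $\overline p=w_{I_0}*w_{K_1}*w_{I_1}*\cdots*w_{K_m}*w_{I_m}$, and it is a reduced expression of $p$ if moreover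 $\overline p=(w_{K_1}w_{I_1}^{-1})\cdots(w_{K_m}w_{I_m}^{-1})\,w_{I_m}$ and $\ell(\overline p)$ is the sum of the lengths of these $m+1$ factors. For an $(I,J)$-coset $p$, a $(J,K)$-coset $q$ and an $(I,K)$-coset $r$, write $p.q=r$, and call $r$ a reduced composition of $p$ and $q$, if there are a reduced expression of $p$ and a reduced expression of $q$ whose concatenation is a reduced expression of $r$. **Theorem.** Let $I,J,K,L\subseteq S$ be finitary, let $q',q$ be $(I,J)$-cosets with $q'<q$, let $p$ be a $(K,I)$-coset and $r$ a $(J,L)$-coset. If $p.q.r$ is a reduced composition (that is, $p.q$ and $(p.q).r$ are both defined as reduced compositions), then $$p*q'*r<p.q.r .$$ -/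

import Mathlib

namespace CoxeterSystem

variable {B : Type*} {W : Type*} [Group W] {M : CoxeterMatrix B}

/-- The standard parabolic subgroup `W_I` generated by the simple reflections in `I`. -/
def parabolic (cs : CoxeterSystem M W) (I : Set B) : Subgroup W :=
  Subgroup.closure (cs.simple '' I)

/-- A finitary subset of the set of simple reflections: a set `I` such that `W_I` is finite. -/
structure FinitarySubset (cs : CoxeterSystem M W) where
  carrier : Set B
  finite : Finite (cs.parabolic carrier)

/-- The parabolic subgroup `W_I` of a finitary subset `I`. -/
def FinitarySubset.subgroup {cs : CoxeterSystem M W} (I : cs.FinitarySubset) : Subgroup W :=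
  cs.parabolic I.carrier

theorem FinitarySubset.exists_longest {cs : CoxeterSystem M W} (I : cs.FinitarySubset) :
    ∃ w ∈ I.subgroup, ∀ v ∈ I.subgroup, cs.length v ≤ cs.length w := by
  have hfin : (I.subgroup : Set W).Finite := Set.finite_coe_iff.mp I.finite
  exact Set.exists_max_image _ cs.length hfin ⟨1, I.subgroup.one_mem⟩

/-- The longest element `w_I` of the finite group `W_I`. -/
noncomputable def FinitarySubset.longest {cs : CoxeterSystem M W} (I : cs.FinitarySubset) : W :=
  I.exists_longest.choose

/-- The Bruhat order on `W`: `x ≤ y` if `y` is obtained from `x` by successive multiplications by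
reflections, each of which increases the length. -/
def BruhatLE (cs : CoxeterSystem M W) : W → W → Prop :=
  Relation.ReflTransGen
    (fun u v => ∃ t, cs.IsReflection t ∧ v = u * t ∧ cs.length u < cs.length v)

theorem BruhatLE.eq_or_length_lt {cs : CoxeterSystem M W} {x y : W} (h : cs.BruhatLE x y) :
    x = y ∨ cs.length x < cs.length y := by
  induction h with
  | refl => exact Or.inl rfl
  | tail _ hstep ih =>
    obtain ⟨t, _, _, hlt⟩ := hstep
    rcases ih with rfl | ih
    · exact Or.inr hlt
    · exact Or.inr (ih.trans hlt)

open Classical in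
/-- The product `w * s_1 * ⋯ * s_k` in the Coxeter monoid of an element `w` and of simple
reflections, where `w * s = ws` if `ℓ(ws) > ℓ(w)` and `w * s = w` otherwise. -/
noncomputable def starWord (cs : CoxeterSystem M W) (w : W) (ω : List B) : W :=
  ω.foldl (fun v i =>
    if cs.length v < cs.length (v * cs.simple i) then v * cs.simple i else v) w

/-- The product `x * y` of the Coxeter monoid, or Demazure product, on `W`: a reduced word
`y = s_1 ⋯ s_k` gives `y = s_1 * ⋯ * s_k`, so that `x * y = x * s_1 * ⋯ * s_k`. -/
noncomputable def star (cs : CoxeterSystem M W) (x y : W) : W :=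
  cs.starWord x (cs.exists_isReduced y).choose

/-- The `(I,J)`-cosets, that is, the elements of `W_I \ W / W_J`. -/
def Coset {cs : CoxeterSystem M W} (I J : cs.FinitarySubset) : Type _ :=
  DoubleCoset.Quotient (I.subgroup : Set W) (J.subgroup : Set W)

namespace Coset

variable {cs : CoxeterSystem M W} {I J K : cs.FinitarySubset}

/-- The `(I,J)`-coset `W_I w W_J`. -/
def mk (I J : cs.FinitarySubset) (w : W) : Coset I J :=
  DoubleCoset.mk I.subgroup J.subgroup w

/-- The subset of `W` underlying a coset. -/
def toSet (p : Coset I J) : Set W := {w | mk I J w = p}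

theorem toSet_nonempty (p : Coset I J) : p.toSet.Nonempty := Quotient.exists_rep p

theorem toSet_finite (p : Coset I J) : p.toSet.Finite := by
  obtain ⟨w, hw⟩ := p.toSet_nonempty
  have hI : (I.subgroup : Set W).Finite := Set.finite_coe_iff.mp I.finite
  have hJ : (J.subgroup : Set W).Finite := Set.finite_coe_iff.mp J.finite
  refine (Set.Finite.image2 (fun a b => a * w * b) hI hJ).subset ?_
  intro v hv
  have h : mk I J w = mk I J v := Eq.trans hw (Eq.symm hv)
  obtain ⟨a, ha, b, hb, hab⟩ := DoubleCoset.rel_iff.mp (Quotient.exact h)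
  exact ⟨a, ha, b, hb, hab.symm⟩

theorem exists_maximal (p : Coset I J) :
    ∃ x ∈ p.toSet, ∀ y ∈ p.toSet, cs.BruhatLE x y → y = x := by
  obtain ⟨x, hx, hmax⟩ := Set.exists_max_image _ cs.length p.toSet_finite p.toSet_nonempty
  refine ⟨x, hx, fun y hy hxy => ?_⟩
  rcases hxy.eq_or_length_lt with h | h
  · exact h.symm
  · exact absurd (hmax y hy) (not_le.mpr h)

theorem exists_minimal (p : Coset I J) :
    ∃ x ∈ p.toSet, ∀ y ∈ p.toSet, cs.BruhatLE y x → y = x := by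
  obtain ⟨x, hx, hmin⟩ := Set.exists_min_image _ cs.length p.toSet_finite p.toSet_nonempty
  refine ⟨x, hx, fun y hy hyx => ?_⟩
  rcases hyx.eq_or_length_lt with h | h
  · exact h
  · exact absurd (hmin y hy) (not_le.mpr h)

/-- The maximal element of a coset in the Bruhat order. -/
noncomputable def top (p : Coset I J) : W := p.exists_maximal.choose

/-- The minimal element of a coset in the Bruhat order. -/
noncomputable def bot (p : Coset I J) : W := p.exists_minimal.choose

/-- The Bruhat order on `(I,J)`-cosets. -/
def le (p q : Coset I J) : Prop := cs.BruhatLE p.bot q.bot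

/-- The strict Bruhat order on `(I,J)`-cosets. -/
def lt (p q : Coset I J) : Prop := p.le q ∧ p ≠ q

/-- The product `p * q` of an `(I,J)`-coset and a `(J,K)`-coset: the `(I,K)`-coset whose maximal
element is the product of those of `p` and `q` in the Coxeter monoid. -/
noncomputable def star (p : Coset I J) (q : Coset J K) : Coset I K :=
  mk I K (cs.star p.top q.top)

end Coset

/-- Multistep expressions `[[I₀ ⊆ K₁ ⊇ I₁ ⊆ K₂ ⊇ ⋯ ⊆ K_m ⊇ I_m]]` of finitary subsets, with
`m ≥ 0`; the indices are the two ends `I₀` and `I_m`. -/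
inductive Expression {cs : CoxeterSystem M W} : cs.FinitarySubset → cs.FinitarySubset → Type _
  | nil (I : cs.FinitarySubset) : Expression I I
  | cons {I₀ J : cs.FinitarySubset} (K I₁ : cs.FinitarySubset)
      (hup : I₀.carrier ⊆ K.carrier) (hdown : I₁.carrier ⊆ K.carrier)
      (tail : Expression I₁ J) : Expression I₀ J

namespace Expression

variable {cs : CoxeterSystem M W}

/-- The composition (concatenation) of expressions. -/
def comp {I J K : cs.FinitarySubset} : Expression I J → Expression J K → Expression I K
  | nil _, f => f
  | cons K₁ I₁ hup hdown tail, f => cons K₁ I₁ hup hdown (tail.comp f)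

/-- `x * w_{K₁} * w_{I₁} * ⋯ * w_{K_m} * w_{I_m}`. -/
noncomputable def starFrom {I J : cs.FinitarySubset} : W → Expression I J → W
  | x, nil _ => x
  | x, cons K₁ I₁ _ _ tail => tail.starFrom (cs.star (cs.star x K₁.longest) I₁.longest)

/-- The expression expresses `p`: the maximal element of `p` is
`w_{I₀} * w_{K₁} * w_{I₁} * ⋯ * w_{K_m} * w_{I_m}`. -/
def Expresses {I J : cs.FinitarySubset} (e : Expression I J) (p : Coset I J) : Prop :=
  p.top = e.starFrom I.longest

/-- The list `w_{K₁} w_{I₁}⁻¹, …, w_{K_m} w_{I_m}⁻¹, w_{I_m}`. -/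
noncomputable def factors {I J : cs.FinitarySubset} : Expression I J → List W
  | nil I => [I.longest]
  | cons K₁ I₁ _ _ tail => (K₁.longest * I₁.longest⁻¹) :: tail.factors

/-- The expression is a reduced expression of `p`: it expresses `p`, and the maximal element of `p`
is the product `(w_{K₁} w_{I₁}⁻¹) ⋯ (w_{K_m} w_{I_m}⁻¹) w_{I_m}`, with lengths adding up. -/
def IsReducedExpressionOf {I J : cs.FinitarySubset} (e : Expression I J) (p : Coset I J) : Prop :=
  e.Expresses p ∧ p.top = e.factors.prod ∧
    cs.length e.factors.prod = (e.factors.map cs.length).sum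

end Expression

/-- `p . q = r`: there are reduced expressions of `p` and `q` whose composition is a reduced
expression of `r`. -/
def Coset.IsReducedComposition {cs : CoxeterSystem M W} {I J K : cs.FinitarySubset}
    (p : Coset I J) (q : Coset J K) (r : Coset I K) : Prop :=
  ∃ (e : Expression I J) (f : Expression J K),
    e.IsReducedExpressionOf p ∧ f.IsReducedExpressionOf q ∧ (e.comp f).IsReducedExpressionOf r

end CoxeterSystem

/-! Both the order and the product of cosets can be read off maximal elements. By `le_iff_top` the
order on cosets is the Bruhat order of their tops, and by `top_star` tops multiply by the Demazure
product. That product is monotone in each argument, which gives the weak inequality, since a reduced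
composition is the product `star` (`eq_star`).

Strictness is a count of lengths. In `p * q` over the middle subset `J`, one copy of `w_J` is
absorbed, so the top has length at most `ℓ(top p) + ℓ(top q) - ℓ(w_J)` (`length_top_star_le`), with
equality for a reduced composition (`length_top`). Hence replacing `q` by the strictly shorter `q'`
gives a strictly shorter triple product.

The supporting theory rests on a `ℤ/2`-valued cocycle that detects right inversions. It yields
strong exchange, hence the lifting property of the Bruhat order and the commutation of left and
right Demazure multiplication (`upLeft_upRight`), from which associativity follows. -/

namespace CoxeterSystem

variable {B : Type*} {W : Type*} [Group W] {M : CoxeterMatrix B}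

/-! ### The reflection cocycle -/

open Classical in
/-- The action of a simple reflection on `W × ℤ/2` that conjugates the first component and records
in the second whether it equals that simple reflection. -/
noncomputable def signedConj (cs : CoxeterSystem M W) (i : B) : Function.End (W × ZMod 2) :=
  fun x => (cs.simple i * x.1 * cs.simple i, x.2 + if x.1 = cs.simple i then 1 else 0)

-- The sum runs over `2k` reflections of the dihedral group generated by the two simple reflections;
-- it is made explicit in order to verify the braid relation.
open Classical in
theorem signedConj_mul_pow_apply (cs : CoxeterSystem M W) (i j : B) (k : ℕ) (x : W × ZMod 2) :
    ((cs.signedConj i * cs.signedConj j) ^ k) x =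
      ((cs.simple i * cs.simple j) ^ k * x.1 * (cs.simple j * cs.simple i) ^ k,
        x.2 + ∑ e ∈ Finset.range (2 * k),
          if x.1 = (cs.simple j * cs.simple i) ^ e * cs.simple j then 1 else 0) := by
  induction k with
  | zero =>
    change x = _
    simp
  | succ k ih =>
    have hinv : ((cs.simple i * cs.simple j) ^ k)⁻¹ = (cs.simple j * cs.simple i) ^ k := by
      rw [← inv_pow, mul_inv_rev, inv_simple, inv_simple]
    have hcomm : (cs.simple j) * (cs.simple i * cs.simple j) ^ k
        = (cs.simple j * cs.simple i) ^ k * cs.simple j := by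
      have h : SemiconjBy (cs.simple j) (cs.simple i * cs.simple j)
          (cs.simple j * cs.simple i) := by
        simp [SemiconjBy, mul_assoc]
      exact (h.pow_right k).eq
    have h1 : (cs.simple i * cs.simple j) ^ k * x.1 * (cs.simple j * cs.simple i) ^ k
          = cs.simple j ↔
        x.1 = (cs.simple j * cs.simple i) ^ (2 * k) * cs.simple j := by
      rw [← hinv, mul_inv_eq_iff_eq_mul, ← eq_inv_mul_iff_mul_eq, hinv, hcomm, two_mul, pow_add,
        mul_assoc]
    have h2 : cs.simple j * ((cs.simple i * cs.simple j) ^ k * x.1 *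
          (cs.simple j * cs.simple i) ^ k) * cs.simple j = cs.simple i ↔
        x.1 = (cs.simple j * cs.simple i) ^ (2 * k + 1) * cs.simple j := by
      have h3 : (cs.simple j * cs.simple i) ^ (2 * k + 1) * cs.simple j =
          ((cs.simple i * cs.simple j) ^ k)⁻¹ *
            (cs.simple j * cs.simple i * (cs.simple j * (cs.simple i * cs.simple j) ^ k)) := by
        rw [hcomm, hinv, two_mul, add_right_comm, pow_add, pow_succ]
        simp only [mul_assoc]
      rw [h3, ← hinv]
      generalize (cs.simple i * cs.simple j) ^ k = a
      constructor
      · intro h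
        rw [← h]
        simp [mul_assoc]
      · intro h
        rw [h]
        simp [mul_assoc]
    rw [pow_succ']
    change (cs.signedConj i) ((cs.signedConj j)
      (((cs.signedConj i * cs.signedConj j) ^ k) x)) = _
    rw [ih, mul_add, Finset.sum_range_succ, Finset.sum_range_succ]
    simp only [signedConj, h1, h2]
    refine Prod.ext ?_ ?_
    · simp only [pow_succ' (cs.simple i * cs.simple j), pow_succ (cs.simple j * cs.simple i),
        mul_assoc]
    · simp only [add_assoc]

/-- At `k = M i j` the terms with indices `e` and `e + M i j` coincide, so the sum vanishes mod 2.
-/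
theorem isLiftable_signedConj (cs : CoxeterSystem M W) : M.IsLiftable cs.signedConj := by
  classical
  intro i j
  funext x
  rw [signedConj_mul_pow_apply, simple_mul_simple_pow, simple_mul_simple_pow', two_mul,
    Finset.sum_range_add]
  simp only [pow_add, simple_mul_simple_pow', one_mul, mul_one, CharTwo.add_self_eq_zero, add_zero]
  rfl

/-- The action of `W` on `W × ℤ/2` extending `signedConj`. -/
noncomputable def signedConjHom (cs : CoxeterSystem M W) : W →* Function.End (W × ZMod 2) :=
  cs.lift ⟨cs.signedConj, cs.isLiftable_signedConj⟩

/-- The reflection cocycle, which tells whether a reflection `t` is a right inversion of `w`. -/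
noncomputable def reflectionCocycle (cs : CoxeterSystem M W) (w t : W) : ZMod 2 :=
  (cs.signedConjHom w (t, 0)).2

open Classical in
theorem signedConjHom_simple_apply (cs : CoxeterSystem M W) (i : B) (x : W × ZMod 2) :
    cs.signedConjHom (cs.simple i) x =
      (cs.simple i * x.1 * cs.simple i, x.2 + if x.1 = cs.simple i then 1 else 0) := by
  rw [signedConjHom, lift_apply_simple]
  rfl

theorem signedConjHom_mul_apply (cs : CoxeterSystem M W) (v w : W) (x : W × ZMod 2) :
    cs.signedConjHom (v * w) x = cs.signedConjHom v (cs.signedConjHom w x) := by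
  rw [map_mul]
  rfl

theorem signedConjHom_one_apply (cs : CoxeterSystem M W) (x : W × ZMod 2) :
    cs.signedConjHom 1 x = x := by
  rw [map_one]
  rfl

theorem signedConjHom_apply (cs : CoxeterSystem M W) (w t : W) (ε : ZMod 2) :
    cs.signedConjHom w (t, ε) = (w * t * w⁻¹, ε + cs.reflectionCocycle w t) := by
  classical
  unfold reflectionCocycle
  induction w using cs.simple_induction_left generalizing t ε with
  | one => simp [signedConjHom_one_apply]
  | mul_simple_left w i ih =>
    rw [signedConjHom_mul_apply, signedConjHom_mul_apply, ih t ε, ih t 0,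
      signedConjHom_simple_apply, signedConjHom_simple_apply]
    simp [mul_assoc, add_assoc]

theorem reflectionCocycle_one (cs : CoxeterSystem M W) (t : W) :
    cs.reflectionCocycle 1 t = 0 := by
  rw [reflectionCocycle, signedConjHom_one_apply]

open Classical in
theorem reflectionCocycle_simple (cs : CoxeterSystem M W) (i : B) (t : W) :
    cs.reflectionCocycle (cs.simple i) t = if t = cs.simple i then 1 else 0 := by
  rw [reflectionCocycle, signedConjHom_simple_apply, zero_add]

theorem reflectionCocycle_mul (cs : CoxeterSystem M W) (v w t : W) :
    cs.reflectionCocycle (v * w) t =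
      cs.reflectionCocycle w t + cs.reflectionCocycle v (w * t * w⁻¹) := by
  rw [reflectionCocycle, signedConjHom_mul_apply, signedConjHom_apply, signedConjHom_apply,
    zero_add]

/-- Write `t = u s u⁻¹`: the contributions of `u` and `u⁻¹` cancel because the cocycle is trivial on
`u⁻¹ u`, leaving the value 1 of `s` at `s`. -/
theorem IsReflection.reflectionCocycle_self {cs : CoxeterSystem M W} {t : W}
    (ht : cs.IsReflection t) : cs.reflectionCocycle t t = 1 := by
  obtain ⟨u, i, rfl⟩ := ht
  have h := cs.reflectionCocycle_mul u⁻¹ u (cs.simple i)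
  rw [inv_mul_cancel, reflectionCocycle_one] at h
  rw [reflectionCocycle_mul, reflectionCocycle_mul]
  have h1 : u⁻¹ * (u * cs.simple i * u⁻¹) * u⁻¹⁻¹ = cs.simple i := by simp [mul_assoc]
  rw [h1, reflectionCocycle_simple, if_pos rfl]
  simp only [mul_inv_cancel_right]
  rw [add_left_comm, add_comm _ (cs.reflectionCocycle u (cs.simple i)), ← h, add_zero]

-- A nonzero value forces `t` to occur in the inversion sequence of every word for the element; this
-- is what turns the cocycle into strong exchange.
open Classical in
theorem reflectionCocycle_wordProd (cs : CoxeterSystem M W) (ω : List B) (t : W) :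
    cs.reflectionCocycle (cs.wordProd ω) t = ((cs.rightInvSeq ω).count t : ZMod 2) := by
  induction ω with
  | nil => simp [reflectionCocycle_one]
  | cons i ω ih =>
    rw [wordProd_cons, reflectionCocycle_mul, ih, reflectionCocycle_simple, rightInvSeq,
      List.count_cons]
    have h : (cs.wordProd ω * t * (cs.wordProd ω)⁻¹ = cs.simple i) ↔
        ((cs.wordProd ω)⁻¹ * cs.simple i * cs.wordProd ω = t) := by
      rw [mul_inv_eq_iff_eq_mul, mul_assoc, inv_mul_eq_iff_eq_mul]
      exact eq_comm
    simp [h]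

/-- The strong exchange condition, in terms of the reflection cocycle. -/
theorem IsReflection.length_mul_lt_iff {cs : CoxeterSystem M W} {t : W} (ht : cs.IsReflection t)
    (w : W) : cs.length (w * t) < cs.length w ↔ cs.reflectionCocycle w t = 1 := by
  classical
  have key : ∀ v, cs.reflectionCocycle v t = 1 → cs.length (v * t) < cs.length v := by
    intro v hv
    obtain ⟨ω, hω, rfl⟩ := cs.exists_isReduced v
    refine (cs.isRightInversion_of_mem_rightInvSeq hω (t := t) ?_).2
    by_contra hmem
    rw [reflectionCocycle_wordProd, List.count_eq_zero_of_not_mem hmem] at hv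
    simp at hv
  refine ⟨fun hlt => ?_, key w⟩
  by_contra hne
  have h0 : cs.reflectionCocycle w t = 0 := by
    generalize cs.reflectionCocycle w t = a at hne
    revert a
    decide
  -- The values at `w` and `w t` differ by 1, so value 0 at `w` makes `t` an inversion of `w t`,
  -- against the assumption.
  have h1 := key (w * t) (by
    rw [reflectionCocycle_mul, ht.reflectionCocycle_self, mul_inv_cancel_right, h0, add_zero])
  rw [mul_assoc, ht.mul_self, mul_one] at h1
  exact absurd h1 hlt.not_gt

theorem IsReflection.lt_length_mul_iff {cs : CoxeterSystem M W} {t : W} (ht : cs.IsReflection t)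
    (w : W) : cs.length w < cs.length (w * t) ↔ cs.reflectionCocycle w t ≠ 1 := by
  rw [Ne, ← ht.length_mul_lt_iff, not_lt]
  exact ⟨le_of_lt, fun h => lt_of_le_of_ne h (ht.length_mul_left_ne w).symm⟩

/-- If `u < u t` for a reflection `t` and `s ≠ t` is simple, then `u s < u t s`. -/
theorem IsReflection.length_mul_simple_lt {cs : CoxeterSystem M W} {t u : W}
    (ht : cs.IsReflection t) (hlt : cs.length u < cs.length (u * t)) {i : B}
    (hne : t ≠ cs.simple i) :
    cs.length (u * cs.simple i) < cs.length (u * t * cs.simple i) := by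
  classical
  have ht' : cs.IsReflection (cs.simple i * t * cs.simple i) := by
    simpa using ht.conj (cs.simple i)
  have heq : u * t * cs.simple i = u * cs.simple i * (cs.simple i * t * cs.simple i) := by
    simp [mul_assoc]
  -- Since `s t s ≠ s`, the cocycle of `u s` at `s t s` equals that of `u` at `t`.
  rw [heq, ht'.lt_length_mul_iff, reflectionCocycle_mul, reflectionCocycle_simple, if_neg]
  · rw [zero_add]
    have : cs.simple i * (cs.simple i * t * cs.simple i) * (cs.simple i)⁻¹ = t := by
      simp [mul_assoc]
    rw [this]
    exact (ht.lt_length_mul_iff u).mp hlt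
  · intro h
    apply hne
    have h1 : t = cs.simple i * (cs.simple i * t * cs.simple i) * cs.simple i := by
      simp [mul_assoc]
    rw [h1, h]
    simp

/-! ### The Bruhat order -/

namespace BruhatLE

variable {cs : CoxeterSystem M W}

theorem refl (x : W) : cs.BruhatLE x x := Relation.ReflTransGen.refl

theorem trans {x y z : W} (h : cs.BruhatLE x y) (h' : cs.BruhatLE y z) : cs.BruhatLE x z :=
  Relation.ReflTransGen.trans h h'

theorem antisymm {x y : W} (h : cs.BruhatLE x y) (h' : cs.BruhatLE y x) : x = y := by
  rcases h.eq_or_length_lt with h | h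
  · exact h
  · rcases h'.eq_or_length_lt with h' | h'
    · exact h'.symm
    · exact absurd h h'.not_gt

theorem length_le {x y : W} (h : cs.BruhatLE x y) : cs.length x ≤ cs.length y := by
  rcases h.eq_or_length_lt with rfl | h
  · exact le_rfl
  · exact h.le

theorem mul_reflection {x t : W} (ht : cs.IsReflection t)
    (h : cs.length x < cs.length (x * t)) : cs.BruhatLE x (x * t) :=
  Relation.ReflTransGen.single ⟨t, ht, rfl, h⟩

theorem inv {x y : W} (h : cs.BruhatLE x y) : cs.BruhatLE x⁻¹ y⁻¹ := by
  induction h with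
  | refl => exact refl _
  | @tail u v _ hstep ih =>
    obtain ⟨t, ht, rfl, hlt⟩ := hstep
    refine ih.trans (Relation.ReflTransGen.single ⟨u * t * u⁻¹, ht.conj u, ?_, ?_⟩)
    · simp [mul_assoc, ht.inv]
    · rwa [length_inv, length_inv]

end BruhatLE

variable {cs : CoxeterSystem M W}

theorem bruhatLE_mul_simple {x : W} {i : B} (h : cs.length x < cs.length (x * cs.simple i)) :
    cs.BruhatLE x (x * cs.simple i) :=
  BruhatLE.mul_reflection (cs.isReflection_simple i) h

theorem mul_simple_bruhatLE {x : W} {i : B} (h : cs.length (x * cs.simple i) < cs.length x) :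
    cs.BruhatLE (x * cs.simple i) x := by
  have := bruhatLE_mul_simple (cs := cs) (x := x * cs.simple i) (i := i) (by simpa using h)
  simpa using this

/-- The larger of `x` and `x s`. -/
noncomputable def upRight (cs : CoxeterSystem M W) (x : W) (i : B) : W :=
  open Classical in
  if cs.length x < cs.length (x * cs.simple i) then x * cs.simple i else x

/-- The larger of `x` and `s x`. -/
noncomputable def upLeft (cs : CoxeterSystem M W) (i : B) (x : W) : W :=
  (cs.upRight x⁻¹ i)⁻¹

theorem upRight_of_lt {x : W} {i : B} (h : cs.length x < cs.length (x * cs.simple i)) :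
    cs.upRight x i = x * cs.simple i := if_pos h

theorem upRight_of_gt {x : W} {i : B} (h : cs.length (x * cs.simple i) < cs.length x) :
    cs.upRight x i = x := if_neg h.not_gt

theorem length_mul_simple_lt_or_gt (cs : CoxeterSystem M W) (x : W) (i : B) :
    cs.length x < cs.length (x * cs.simple i) ∨ cs.length (x * cs.simple i) < cs.length x := by
  rcases cs.length_mul_simple x i with h | h <;> omega

theorem length_simple_mul_lt_or_gt (cs : CoxeterSystem M W) (x : W) (i : B) :
    cs.length x < cs.length (cs.simple i * x) ∨ cs.length (cs.simple i * x) < cs.length x := by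
  rcases cs.length_simple_mul x i with h | h <;> omega

theorem length_inv_mul_simple (cs : CoxeterSystem M W) (x : W) (i : B) :
    cs.length (x⁻¹ * cs.simple i) = cs.length (cs.simple i * x) := by
  rw [← length_inv]
  simp

theorem upLeft_of_lt {x : W} {i : B} (h : cs.length x < cs.length (cs.simple i * x)) :
    cs.upLeft i x = cs.simple i * x := by
  rw [upLeft, upRight_of_lt (by rwa [length_inv_mul_simple, length_inv])]
  simp

theorem upLeft_of_gt {x : W} {i : B} (h : cs.length (cs.simple i * x) < cs.length x) :
    cs.upLeft i x = x := by
  rw [upLeft, upRight_of_gt (by rwa [length_inv_mul_simple, length_inv])]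
  simp

theorem upRight_eq_self_iff {x : W} {i : B} :
    cs.upRight x i = x ↔ cs.length (x * cs.simple i) < cs.length x := by
  refine ⟨fun h => ?_, upRight_of_gt⟩
  rcases cs.length_mul_simple_lt_or_gt x i with h' | h'
  · rw [upRight_of_lt h'] at h
    rw [h] at h'
    exact absurd h' (lt_irrefl _)
  · exact h'

theorem upLeft_eq_self_iff {x : W} {i : B} :
    cs.upLeft i x = x ↔ cs.length (cs.simple i * x) < cs.length x := by
  rw [upLeft, inv_eq_iff_eq_inv, upRight_eq_self_iff, length_inv_mul_simple, length_inv]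

theorem bruhatLE_upRight (x : W) (i : B) : cs.BruhatLE x (cs.upRight x i) := by
  rcases cs.length_mul_simple_lt_or_gt x i with h | h
  · rw [upRight_of_lt h]
    exact bruhatLE_mul_simple h
  · rw [upRight_of_gt h]
    exact BruhatLE.refl x

theorem mul_simple_bruhatLE_upRight (x : W) (i : B) :
    cs.BruhatLE (x * cs.simple i) (cs.upRight x i) := by
  rcases cs.length_mul_simple_lt_or_gt x i with h | h
  · rw [upRight_of_lt h]
    exact BruhatLE.refl _
  · rw [upRight_of_gt h]
    exact mul_simple_bruhatLE h

theorem simple_mul_bruhatLE_upLeft (x : W) (i : B) :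
    cs.BruhatLE (cs.simple i * x) (cs.upLeft i x) := by
  simpa [upLeft] using (mul_simple_bruhatLE_upRight (cs := cs) x⁻¹ i).inv

/-- It suffices to treat one step `u < u t`. If `t = s` and `u < u s`, both sides become `u s`; if
`t ≠ s`, right multiplication by `s` preserves the step. -/
theorem BruhatLE.upRight {x y : W} (h : cs.BruhatLE x y) (i : B) :
    cs.BruhatLE (cs.upRight x i) (cs.upRight y i) := by
  induction h with
  | refl => exact BruhatLE.refl _
  | @tail u v _ hstep ih =>
    obtain ⟨t, ht, rfl, hlt⟩ := hstep
    refine ih.trans ?_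
    rcases cs.length_mul_simple_lt_or_gt u i with h | h
    · by_cases hti : t = cs.simple i
      · subst hti
        rw [upRight_of_lt h, upRight_of_gt (by simpa using h)]
        exact BruhatLE.refl _
      · rw [upRight_of_lt h]
        refine BruhatLE.trans ?_ (mul_simple_bruhatLE_upRight _ i)
        refine Relation.ReflTransGen.single ⟨cs.simple i * t * (cs.simple i)⁻¹,
          ht.conj _, by simp [mul_assoc], ht.length_mul_simple_lt hlt hti⟩
    · rw [upRight_of_gt h]
      exact (BruhatLE.mul_reflection ht hlt).trans (bruhatLE_upRight _ i)

theorem BruhatLE.upLeft {x y : W} (h : cs.BruhatLE x y) (i : B) :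
    cs.BruhatLE (cs.upLeft i x) (cs.upLeft i y) := (h.inv.upRight i).inv

/-- If `x ≤ y` and `y s < y`, then `x ≤ y s` or `x s ≤ y s`. -/
theorem BruhatLE.le_or_mul_simple_le {x y : W} (h : cs.BruhatLE x y) {i : B}
    (hi : cs.length (y * cs.simple i) < cs.length y) :
    cs.BruhatLE x (y * cs.simple i) ∨ cs.BruhatLE (x * cs.simple i) (y * cs.simple i) := by
  induction h with
  | refl => exact Or.inr (BruhatLE.refl _)
  | @tail u v _ hstep ih =>
    obtain ⟨t, ht, rfl, hlt⟩ := hstep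
    by_cases hti : t = cs.simple i
    · subst hti
      rename_i hxu
      left
      rw [simple_mul_simple_cancel_right]
      exact hxu
    · have hstep : cs.BruhatLE (u * cs.simple i) (u * t * cs.simple i) :=
        Relation.ReflTransGen.single ⟨cs.simple i * t * (cs.simple i)⁻¹,
          ht.conj _, by simp [mul_assoc], ht.length_mul_simple_lt hlt hti⟩
      rcases cs.length_mul_simple_lt_or_gt u i with h | h
      · rename_i hxu
        exact Or.inl (hxu.trans ((bruhatLE_mul_simple h).trans hstep))
      · exact (ih h).imp (·.trans hstep) (·.trans hstep)

theorem BruhatLE.le_or_simple_mul_le {x y : W} (h : cs.BruhatLE x y) {i : B}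
    (hi : cs.length (cs.simple i * y) < cs.length y) :
    cs.BruhatLE x (cs.simple i * y) ∨ cs.BruhatLE (cs.simple i * x) (cs.simple i * y) := by
  have := h.inv.le_or_mul_simple_le (i := i) (by rwa [length_inv_mul_simple, length_inv])
  refine this.imp (fun h => ?_) (fun h => ?_) <;> simpa using h.inv

/-- If `x ≤ y` and `x < x s`, then `x ≤ y s`. -/
theorem BruhatLE.le_mul_simple {x y : W} (h : cs.BruhatLE x y) {i : B}
    (hi : cs.length x < cs.length (x * cs.simple i)) : cs.BruhatLE x (y * cs.simple i) := by
  rcases cs.length_mul_simple_lt_or_gt y i with hy | hy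
  · exact h.trans (bruhatLE_mul_simple hy)
  · exact (h.le_or_mul_simple_le hy).elim id ((bruhatLE_mul_simple hi).trans ·)

theorem BruhatLE.le_simple_mul {x y : W} (h : cs.BruhatLE x y) {i : B}
    (hi : cs.length x < cs.length (cs.simple i * x)) : cs.BruhatLE x (cs.simple i * y) := by
  have := (h.inv.le_mul_simple (i := i) (by rwa [length_inv_mul_simple, length_inv])).inv
  simpa using this

/-! ### The Demazure product -/

/-- Left and right Demazure multiplication commute. The delicate case is when both lengthen `w`:
either `s w = w s'` and both sides equal this element, or exchange shows that `s w s'` is longer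
than both. -/
theorem upLeft_upRight (cs : CoxeterSystem M W) (i j : B) (w : W) :
    cs.upLeft i (cs.upRight w j) = cs.upRight (cs.upLeft i w) j := by
  rcases cs.length_mul_simple_lt_or_gt w j with hj | hj <;>
    rcases cs.length_simple_mul_lt_or_gt w i with hi | hi
  · rw [upRight_of_lt hj, upLeft_of_lt hi]
    by_cases heq : cs.simple i * w = w * cs.simple j
    · rw [heq, upLeft_of_gt, upRight_of_gt]
      · simpa using hj
      · rw [← heq]
        simpa using hi
    · have hconj : w * (w⁻¹ * cs.simple i * w) = cs.simple i * w := by simp [mul_assoc]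
      have ht : cs.IsReflection (w⁻¹ * cs.simple i * w) := by
        simpa using (cs.isReflection_simple i).conj w⁻¹
      have hlt := ht.length_mul_simple_lt (u := w) (by rwa [hconj]) (i := j) (by
        intro h
        rw [h] at hconj
        exact heq hconj.symm)
      rw [hconj] at hlt
      rw [upLeft_of_lt (by rwa [← mul_assoc]), upRight_of_lt, mul_assoc]
      have h1 := cs.length_mul_simple w j
      have h2 := cs.length_simple_mul w i
      omega
  · rw [upRight_of_lt hj, upLeft_of_gt hi, upRight_of_lt hj, upLeft_of_gt]
    have h1 := cs.length_mul_le (cs.simple i * w) (cs.simple j)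
    rw [mul_assoc, length_simple] at h1
    have h2 := cs.length_mul_simple w j
    have h3 := cs.length_simple_mul w i
    have h4 := cs.length_simple_mul (w * cs.simple j) i
    omega
  · rw [upRight_of_gt hj, upLeft_of_lt hi, upRight_of_gt]
    have h1 := cs.length_mul_le (cs.simple i) (w * cs.simple j)
    rw [← mul_assoc, length_simple] at h1
    have h2 := cs.length_mul_simple w j
    have h3 := cs.length_simple_mul w i
    omega
  · rw [upRight_of_gt hj, upLeft_of_gt hi, upRight_of_gt hj]

theorem starWord_nil (x : W) : cs.starWord x [] = x := rfl

theorem starWord_cons (x : W) (i : B) (ω : List B) :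
    cs.starWord x (i :: ω) = cs.starWord (cs.upRight x i) ω := rfl

theorem upLeft_starWord (i : B) (x : W) (ω : List B) :
    cs.upLeft i (cs.starWord x ω) = cs.starWord (cs.upLeft i x) ω := by
  induction ω generalizing x with
  | nil => rfl
  | cons j ω ih => rw [starWord_cons, starWord_cons, ih, upLeft_upRight]

theorem starWord_of_length_mul {x : W} {ω : List B}
    (h : cs.length (x * cs.wordProd ω) = cs.length x + ω.length) :
    cs.starWord x ω = x * cs.wordProd ω := by
  induction ω generalizing x with
  | nil => simp [starWord_nil]
  | cons i ω ih =>
    rw [wordProd_cons, ← mul_assoc, List.length_cons] at h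
    have h1 := cs.length_mul_le (x * cs.simple i) (cs.wordProd ω)
    have h2 := cs.length_wordProd_le ω
    have h3 := cs.length_mul_simple x i
    rw [starWord_cons, upRight_of_lt (by omega), wordProd_cons, ← mul_assoc]
    exact ih (by omega)

theorem starWord_one {ω : List B} (h : cs.IsReduced ω) : cs.starWord 1 ω = cs.wordProd ω := by
  rw [starWord_of_length_mul, one_mul]
  rw [one_mul, length_one, zero_add, h.eq]

theorem starWord_wordProd {α : List B} (hα : cs.IsReduced α) (ω : List B) :
    cs.starWord (cs.wordProd α) ω = α.foldr cs.upLeft (cs.starWord 1 ω) := by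
  induction α with
  | nil => simp
  | cons i α ih =>
    have hred : cs.IsReduced α := by simpa using hα.drop 1
    have h1 := hα.eq
    rw [wordProd_cons, List.length_cons] at h1
    have h2 := hred.eq
    rw [List.foldr_cons, ← ih hred, upLeft_starWord, upLeft_of_lt (by omega), wordProd_cons]

theorem exists_star_eq_starWord (cs : CoxeterSystem M W) (y : W) :
    ∃ ω : List B, cs.IsReduced ω ∧ y = cs.wordProd ω ∧ ∀ x, cs.star x y = cs.starWord x ω :=
  ⟨_, (cs.exists_isReduced y).choose_spec.1, (cs.exists_isReduced y).choose_spec.2, fun _ => rfl⟩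

/-- `star` is defined by a word for its right factor; this is the mirror description by a word for
the left factor. Having both makes associativity and monotonicity in each argument inductions on a
single word. -/
theorem exists_star_eq_foldr (cs : CoxeterSystem M W) (x : W) :
    ∃ α : List B, cs.IsReduced α ∧ x = cs.wordProd α ∧
      ∀ y, cs.star x y = α.foldr cs.upLeft y := by
  obtain ⟨α, hα, hx⟩ := cs.exists_isReduced x
  refine ⟨α, hα, hx, fun y => ?_⟩
  obtain ⟨ω, hω, hy, hstar⟩ := cs.exists_star_eq_starWord y
  rw [hstar, hx, starWord_wordProd hα, starWord_one hω, hy]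

theorem star_assoc (cs : CoxeterSystem M W) (x y z : W) :
    cs.star (cs.star x y) z = cs.star x (cs.star y z) := by
  obtain ⟨α, -, -, hα⟩ := cs.exists_star_eq_foldr x
  obtain ⟨ω, -, -, hω⟩ := cs.exists_star_eq_starWord z
  rw [hα, hα, hω, hω]
  clear hα
  induction α with
  | nil => rfl
  | cons i α ih => rw [List.foldr_cons, List.foldr_cons, ← ih, upLeft_starWord]

theorem BruhatLE.star_right {x y : W} (h : cs.BruhatLE x y) (z : W) :
    cs.BruhatLE (cs.star x z) (cs.star y z) := by
  obtain ⟨ω, -, -, hω⟩ := cs.exists_star_eq_starWord z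
  rw [hω, hω]
  clear hω
  induction ω generalizing x y with
  | nil => exact h
  | cons i ω ih => exact ih (h.upRight i)

theorem BruhatLE.star_left {x y : W} (h : cs.BruhatLE x y) (z : W) :
    cs.BruhatLE (cs.star z x) (cs.star z y) := by
  obtain ⟨α, -, -, hα⟩ := cs.exists_star_eq_foldr z
  rw [hα, hα]
  clear hα
  induction α with
  | nil => exact h
  | cons i α ih => exact ih.upLeft i

theorem star_eq_mul {x y : W} (h : cs.length (x * y) = cs.length x + cs.length y) :
    cs.star x y = x * y := by
  obtain ⟨ω, hω, hy, hstar⟩ := cs.exists_star_eq_starWord y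
  subst hy
  rw [hstar, starWord_of_length_mul]
  rw [h, hω.eq]

theorem length_upRight_le (x : W) (i : B) : cs.length (cs.upRight x i) ≤ cs.length x + 1 := by
  rcases cs.length_mul_simple_lt_or_gt x i with h | h
  · rw [upRight_of_lt h]
    simpa using cs.length_mul_le x (cs.simple i)
  · rw [upRight_of_gt h]
    omega

theorem length_star_le (cs : CoxeterSystem M W) (x y : W) :
    cs.length (cs.star x y) ≤ cs.length x + cs.length y := by
  obtain ⟨ω, hω, hy, hstar⟩ := cs.exists_star_eq_starWord y
  rw [hstar, hy, hω.eq]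
  clear hstar hω hy
  induction ω generalizing x with
  | nil => simp [starWord_nil]
  | cons i ω ih =>
    rw [starWord_cons, List.length_cons]
    have h1 := ih (cs.upRight x i)
    have h2 := length_upRight_le (cs := cs) x i
    omega

theorem star_simple (x : W) (i : B) : cs.star x (cs.simple i) = cs.upRight x i := by
  rcases cs.length_mul_simple_lt_or_gt x i with h | h
  · rw [upRight_of_lt h, star_eq_mul]
    have := cs.length_mul_simple x i
    rw [length_simple]
    omega
  · have hx : x = cs.star (x * cs.simple i) (cs.simple i) := by
      rw [star_eq_mul] <;> rw [simple_mul_simple_cancel_right]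
      have := cs.length_mul_simple x i
      rw [length_simple]
      omega
    have hs : cs.star (cs.simple i) (cs.simple i) = cs.simple i := by
      obtain ⟨ω, hω, hy, hstar⟩ := cs.exists_star_eq_starWord (cs.simple i)
      have hlen := hω.eq
      rw [← hy, length_simple] at hlen
      -- The chosen reduced word is a single letter `j`; only the equality of simple reflections,
      -- not `j = i`, is needed.
      obtain ⟨j, rfl⟩ := List.length_eq_one_iff.mp hlen.symm
      rw [wordProd_singleton] at hy
      rw [hstar, starWord_cons, starWord_nil, upRight_of_gt]
      rw [← hy, simple_mul_simple_self, length_one, length_simple]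
      exact one_pos
    rw [upRight_of_gt h, hx, star_assoc, hs, ← hx]

theorem simple_star (x : W) (i : B) : cs.star (cs.simple i) x = cs.upLeft i x := by
  obtain ⟨ω, hω, hx, hstar⟩ := cs.exists_star_eq_starWord x
  have h : cs.simple i = cs.upLeft i 1 := by
    rw [upLeft_of_lt, mul_one]
    simp
  rw [hstar, h, ← upLeft_starWord, starWord_one hω, ← hx]

/-! ### Parabolic subgroups -/

theorem parabolic_induction {I : Set B} {P : W → Prop} (one : P 1)
    (mul_simple : ∀ w ∈ cs.parabolic I, ∀ i ∈ I, P w → P (w * cs.simple i)) {w : W}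
    (hw : w ∈ cs.parabolic I) : P w := by
  induction hw using Subgroup.closure_induction_right with
  | one => exact one
  | mul_right x hx y hy ih =>
    obtain ⟨i, hi, rfl⟩ := hy
    exact mul_simple x hx i hi ih
  | mul_inv_cancel x hx y hy ih =>
    obtain ⟨i, hi, rfl⟩ := hy
    rw [inv_simple]
    exact mul_simple x hx i hi ih

theorem simple_mem_parabolic {I : Set B} {i : B} (hi : i ∈ I) :
    cs.simple i ∈ cs.parabolic I :=
  Subgroup.subset_closure ⟨i, hi, rfl⟩

theorem star_of_mem_parabolic {I : Set B} {x w : W} (hx : ∀ i ∈ I, cs.upLeft i x = x)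
    (hw : w ∈ cs.parabolic I) : cs.star w x = x := by
  refine parabolic_induction (P := fun w => cs.star w x = x) ?_ ?_ hw
  · rw [star_eq_mul] <;> simp
  · intro v _ i hi hv
    have hsx : cs.star (cs.simple i) x = x := by rw [simple_star, hx i hi]
    rcases cs.length_mul_simple_lt_or_gt v i with h | h
    · rw [← upRight_of_lt h, ← star_simple, star_assoc, hsx, hv]
    -- Going down, `v = (v s) * s`, so `v * x = (v s) * (s * x) = (v s) * x`.
    · have hv' : cs.star (v * cs.simple i) (cs.simple i) = v := by
        rw [star_simple, upRight_of_lt (by simpa using h), simple_mul_simple_cancel_right]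
      rw [← hsx, ← star_assoc, hv', hv, hsx]

/-- An element that is longest in its coset `x W_I` satisfies `ℓ(x w) + ℓ(w) = ℓ(x)` for
`w ∈ W_I`. -/
theorem length_mul_add_length_of_mem_parabolic {I : Set B} {x w : W}
    (hx : ∀ v ∈ cs.parabolic I, cs.length (x * v) ≤ cs.length x) (hw : w ∈ cs.parabolic I) :
    cs.length (x * w) + cs.length w = cs.length x := by
  refine parabolic_induction (P := fun w => cs.length (x * w) + cs.length w = cs.length x) ?_ ?_ hw
  · simp
  · intro v hv i hi ih
    -- The reflection `v s v⁻¹` lies in `W_I`, so it is an inversion of `x`. The cocycle identity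
    -- then makes `s` a right descent of exactly one of `x v` and `v`, and the sum of their lengths
    -- is unchanged.
    have ht : cs.IsReflection (v * cs.simple i * v⁻¹) := (cs.isReflection_simple i).conj v
    have hmem : v * cs.simple i * v⁻¹ ∈ cs.parabolic I :=
      mul_mem (mul_mem hv (simple_mem_parabolic hi)) (inv_mem hv)
    have h1 : cs.reflectionCocycle x (v * cs.simple i * v⁻¹) = 1 :=
      (ht.length_mul_lt_iff x).mp (lt_of_le_of_ne (hx _ hmem) (ht.length_mul_left_ne x))
    have h2 := cs.reflectionCocycle_mul x v (cs.simple i)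
    rw [h1] at h2
    have h3 := (cs.isReflection_simple i).length_mul_lt_iff (x * v)
    have h4 := (cs.isReflection_simple i).length_mul_lt_iff v
    have h5 : cs.reflectionCocycle (x * v) (cs.simple i) = 1 ↔
        ¬ cs.reflectionCocycle v (cs.simple i) = 1 := by
      rw [h2]
      generalize cs.reflectionCocycle v (cs.simple i) = a
      revert a
      decide
    rw [← h3, ← h4] at h5
    have h6 := cs.length_mul_simple (x * v) i
    have h7 := cs.length_mul_simple v i
    rw [← mul_assoc]
    omega

theorem FinitarySubset.longest_mem (I : cs.FinitarySubset) : I.longest ∈ I.subgroup :=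
  I.exists_longest.choose_spec.1

/-! ### Double cosets -/

namespace Coset

variable {I J K : cs.FinitarySubset}

theorem mk_eq_mk_iff {x y : W} :
    mk I J x = mk I J y ↔ ∃ a ∈ I.subgroup, ∃ b ∈ J.subgroup, y = a * x * b :=
  DoubleCoset.eq _ _ _ _

theorem mk_mul {a b : W} (ha : a ∈ I.subgroup) (hb : b ∈ J.subgroup) (x : W) :
    mk I J (a * x * b) = mk I J x :=
  (mk_eq_mk_iff.mpr ⟨a, ha, b, hb, rfl⟩).symm

theorem mk_mul_simple {i : B} (hi : i ∈ J.carrier) (x : W) :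
    mk I J (x * cs.simple i) = mk I J x := by
  simpa using mk_mul (I := I) (J := J) (one_mem _) (simple_mem_parabolic (cs := cs) hi) x

theorem mk_simple_mul {i : B} (hi : i ∈ I.carrier) (x : W) :
    mk I J (cs.simple i * x) = mk I J x := by
  simpa using mk_mul (I := I) (J := J) (simple_mem_parabolic (cs := cs) hi) (one_mem _) x

theorem mk_induction {P : W → Prop} (left : ∀ i ∈ I.carrier, ∀ w, P w → P (cs.simple i * w))
    (right : ∀ i ∈ J.carrier, ∀ w, P w → P (w * cs.simple i)) {x y : W}
    (h : mk I J x = mk I J y) (hx : P x) : P y := by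
  obtain ⟨a, ha, b, hb, rfl⟩ := mk_eq_mk_iff.mp h
  refine parabolic_induction (P := fun b => P (a * x * b)) ?_ ?_ hb
  · rw [mul_one]
    refine parabolic_induction (P := fun a => ∀ z, P z → P (a * z)) ?_ ?_ ha x hx
    · intro z hz
      rwa [one_mul]
    · intro v _ i hi ih z hz
      rw [mul_assoc]
      exact ih _ (left i hi z hz)
  · intro v _ i hi hv
    rw [← mul_assoc]
    exact right i hi _ hv

theorem mk_top (p : Coset I J) : mk I J p.top = p := p.exists_maximal.choose_spec.1

theorem mk_bot (p : Coset I J) : mk I J p.bot = p := p.exists_minimal.choose_spec.1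

theorem top_maximal (p : Coset I J) {y : W} (hy : mk I J y = p) (h : cs.BruhatLE p.top y) :
    y = p.top := p.exists_maximal.choose_spec.2 y hy h

theorem bot_minimal (p : Coset I J) {y : W} (hy : mk I J y = p) (h : cs.BruhatLE y p.bot) :
    y = p.bot := p.exists_minimal.choose_spec.2 y hy h

theorem upRight_top (p : Coset I J) {i : B} (hi : i ∈ J.carrier) :
    cs.upRight p.top i = p.top := by
  rw [upRight_eq_self_iff]
  refine (cs.length_mul_simple_lt_or_gt p.top i).resolve_left fun h => ?_
  have := p.top_maximal ((mk_mul_simple hi _).trans p.mk_top) (bruhatLE_mul_simple h)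
  rw [this] at h
  exact lt_irrefl _ h

theorem upLeft_top (p : Coset I J) {i : B} (hi : i ∈ I.carrier) :
    cs.upLeft i p.top = p.top := by
  rw [upLeft_eq_self_iff]
  refine (cs.length_simple_mul_lt_or_gt p.top i).resolve_left fun h => ?_
  have h' := (bruhatLE_upRight (cs := cs) p.top⁻¹ i).inv
  rw [inv_inv] at h'
  change cs.BruhatLE _ (cs.upLeft i p.top) at h'
  rw [upLeft_of_lt h] at h'
  have := p.top_maximal ((mk_simple_mul hi _).trans p.mk_top) h'
  rw [this] at h
  exact lt_irrefl _ h

theorem length_bot_lt_mul_simple (p : Coset I J) {i : B} (hi : i ∈ J.carrier) :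
    cs.length p.bot < cs.length (p.bot * cs.simple i) := by
  refine (cs.length_mul_simple_lt_or_gt p.bot i).resolve_right fun h => ?_
  have := p.bot_minimal ((mk_mul_simple hi _).trans p.mk_bot) (mul_simple_bruhatLE h)
  rw [this] at h
  exact lt_irrefl _ h

theorem length_bot_lt_simple_mul (p : Coset I J) {i : B} (hi : i ∈ I.carrier) :
    cs.length p.bot < cs.length (cs.simple i * p.bot) := by
  refine (cs.length_simple_mul_lt_or_gt p.bot i).resolve_right fun h => ?_
  have h' := simple_mul_bruhatLE_upLeft (cs := cs) p.bot i
  rw [upLeft_of_gt h] at h'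
  have := p.bot_minimal ((mk_simple_mul hi _).trans p.mk_bot) h'
  rw [this] at h
  exact lt_irrefl _ h

/-- If some element of the coset of `x` lies below `z` and `z` is stable under the Demazure
products with `I` and `J`, then all elements of the coset lie below `z`. -/
theorem bruhatLE_of_mk_eq {x y z : W} (hl : ∀ i ∈ I.carrier, cs.upLeft i z = z)
    (hr : ∀ i ∈ J.carrier, cs.upRight z i = z) (h : mk I J x = mk I J y)
    (hxz : cs.BruhatLE x z) : cs.BruhatLE y z := by
  refine mk_induction (P := fun y => cs.BruhatLE y z) ?_ ?_ h hxz
  · intro i hi w hw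
    rw [← hl i hi]
    exact (simple_mul_bruhatLE_upLeft w i).trans (hw.upLeft i)
  · intro i hi w hw
    rw [← hr i hi]
    exact (mul_simple_bruhatLE_upRight w i).trans (hw.upRight i)

/-- `top` is chosen as some maximal element; having no ascents in `I` or `J`, it is in fact the
greatest. -/
theorem bruhatLE_top {p : Coset I J} {y : W} (hy : mk I J y = p) : cs.BruhatLE y p.top :=
  bruhatLE_of_mk_eq (fun _ => p.upLeft_top) (fun _ => p.upRight_top)
    (p.mk_top.trans hy.symm) (BruhatLE.refl _)

theorem eq_top {p : Coset I J} {x : W} (hx : mk I J x = p)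
    (hl : ∀ i ∈ I.carrier, cs.upLeft i x = x) (hr : ∀ i ∈ J.carrier, cs.upRight x i = x) :
    p.top = x :=
  (bruhatLE_of_mk_eq hl hr (hx.trans p.mk_top.symm) (BruhatLE.refl _)).antisymm (bruhatLE_top hx)

theorem bruhatLE_of_no_descent {x y : W}
    (hl : ∀ i ∈ I.carrier, cs.length x < cs.length (cs.simple i * x))
    (hr : ∀ i ∈ J.carrier, cs.length x < cs.length (x * cs.simple i))
    (h : mk I J x = mk I J y) : cs.BruhatLE x y :=
  mk_induction (P := fun y => cs.BruhatLE x y) (fun i hi _ hw => hw.le_simple_mul (hl i hi))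
    (fun i hi _ hw => hw.le_mul_simple (hr i hi)) h (BruhatLE.refl _)

theorem bot_bruhatLE {p : Coset I J} {y : W} (hy : mk I J y = p) : cs.BruhatLE p.bot y :=
  bruhatLE_of_no_descent (fun _ => p.length_bot_lt_simple_mul)
    (fun _ => p.length_bot_lt_mul_simple) (p.mk_bot.trans hy.symm)

/-- Descend from `y` to the bottom of its coset; at each descent the lifting property keeps below it
either the current `x` or its neighbour in the same coset. -/
theorem le_of_bruhatLE {p q : Coset I J} {x y : W} (hx : mk I J x = p) (hy : mk I J y = q)
    (h : cs.BruhatLE x y) : p.le q := by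
  induction hn : cs.length y using Nat.strong_induction_on generalizing x y with
  | _ n ih =>
  subst hn
  by_cases hl : ∃ i ∈ I.carrier, cs.length (cs.simple i * y) < cs.length y
  · obtain ⟨i, hi, hlt⟩ := hl
    have hy' := (mk_simple_mul hi _).trans hy
    rcases h.le_or_simple_mul_le hlt with h' | h'
    · exact ih _ hlt hx hy' h' rfl
    · exact ih _ hlt ((mk_simple_mul hi _).trans hx) hy' h' rfl
  by_cases hr : ∃ i ∈ J.carrier, cs.length (y * cs.simple i) < cs.length y
  · obtain ⟨i, hi, hlt⟩ := hr
    have hy' := (mk_mul_simple hi _).trans hy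
    rcases h.le_or_mul_simple_le hlt with h' | h'
    · exact ih _ hlt hx hy' h' rfl
    · exact ih _ hlt ((mk_mul_simple hi _).trans hx) hy' h' rfl
  · push Not at hl hr
    refine (bot_bruhatLE hx).trans (h.trans (bruhatLE_of_no_descent
      (fun i hi => lt_of_le_of_ne (hl i hi) (cs.length_simple_mul_ne y i).symm)
      (fun i hi => lt_of_le_of_ne (hr i hi) (cs.length_mul_simple_ne y i).symm)
      (hy.trans q.mk_bot.symm)))

/-- The Bruhat order on cosets can be tested on maximal elements. -/
theorem le_iff_top {p q : Coset I J} : p.le q ↔ cs.BruhatLE p.top q.top := by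
  refine ⟨fun h => ?_, le_of_bruhatLE p.mk_top q.mk_top⟩
  exact bruhatLE_of_mk_eq (fun _ => q.upLeft_top) (fun _ => q.upRight_top)
    (p.mk_bot.trans p.mk_top.symm) (BruhatLE.trans h (bruhatLE_top q.mk_bot))

theorem lt_iff_top {p q : Coset I J} :
    p.lt q ↔ cs.BruhatLE p.top q.top ∧ cs.length p.top < cs.length q.top := by
  rw [lt, le_iff_top]
  refine and_congr_right fun h => ⟨fun hne => ?_, ?_⟩
  · refine h.eq_or_length_lt.resolve_left fun heq => hne ?_
    rw [← p.mk_top, heq, q.mk_top]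
  · rintro hlt rfl
    exact lt_irrefl _ hlt

/-! ### Products of double cosets -/

/-- The product of two tops absorbs `I` on the left and `K` on the right by associativity, so it has
no ascents there and is itself a top. -/
theorem top_star (p : Coset I J) (q : Coset J K) : (p.star q).top = cs.star p.top q.top := by
  refine eq_top rfl (fun i hi => ?_) (fun i hi => ?_)
  · rw [← simple_star, ← star_assoc, simple_star, p.upLeft_top hi]
  · rw [← star_simple, star_assoc, star_simple, q.upRight_top hi]

theorem length_top_mul_longest_inv (p : Coset I J) :
    cs.length (p.top * J.longest⁻¹) + cs.length J.longest = cs.length p.top := by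
  rw [← cs.length_inv J.longest]
  refine length_mul_add_length_of_mem_parabolic (fun v hv => ?_) (inv_mem J.longest_mem)
  refine (bruhatLE_top (p := p) ?_).length_le
  have := mk_mul (I := I) (J := J) (one_mem _) hv p.top
  rwa [one_mul, p.mk_top] at this

/-- Factor `top p = (top p w_J⁻¹) * w_J` with lengths adding; the top of `q` absorbs `w_J`. This is
the source of the saving `ℓ(w_J)`. -/
theorem top_star_eq_star_mul_longest_inv (p : Coset I J) (q : Coset J K) :
    (p.star q).top = cs.star (p.top * J.longest⁻¹) q.top := by
  have h : cs.star (p.top * J.longest⁻¹) J.longest = p.top := by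
    rw [star_eq_mul] <;> rw [inv_mul_cancel_right]
    exact p.length_top_mul_longest_inv.symm
  rw [top_star]
  conv_lhs => rw [← h]
  rw [star_assoc, star_of_mem_parabolic (fun _ => q.upLeft_top) J.longest_mem]

theorem length_top_star_le (p : Coset I J) (q : Coset J K) :
    cs.length (p.star q).top + cs.length J.longest ≤ cs.length p.top + cs.length q.top := by
  rw [top_star_eq_star_mul_longest_inv]
  have h1 := cs.length_star_le (p.top * J.longest⁻¹) q.top
  have h2 := p.length_top_mul_longest_inv
  omega

end Coset

/-! ### Reduced compositions -/

/-- Concatenation replaces the final factor `w_J` of `e` by the factors of `f`. -/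
theorem Expression.exists_factors_comp {I J K : cs.FinitarySubset} (e : Expression I J)
    (f : Expression J K) :
    ∃ a : List W, e.factors = a ++ [J.longest] ∧ (e.comp f).factors = a ++ f.factors := by
  induction e with
  | nil I => exact ⟨[], rfl, rfl⟩
  | cons K₁ I₁ hup hdown tail ih =>
    obtain ⟨a, h1, h2⟩ := ih f
    exact ⟨(K₁.longest * I₁.longest⁻¹) :: a, by simp [factors, h1], by simp [comp, factors, h2]⟩

theorem length_prod_le_sum (cs : CoxeterSystem M W) (a : List W) :
    cs.length a.prod ≤ (a.map cs.length).sum := by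
  induction a with
  | nil => simp
  | cons x a ih =>
    rw [List.prod_cons, List.map_cons, List.sum_cons]
    exact (cs.length_mul_le _ _).trans (Nat.add_le_add_left ih _)

namespace Coset.IsReducedComposition

variable {I J K : cs.FinitarySubset} {p : Coset I J} {q : Coset J K} {r : Coset I K}

theorem length_mul_longest_inv_mul (h : p.IsReducedComposition q r) :
    r.top = p.top * J.longest⁻¹ * q.top ∧
      cs.length (p.top * J.longest⁻¹ * q.top) =
        cs.length (p.top * J.longest⁻¹) + cs.length q.top := by
  obtain ⟨e, f, ⟨-, he, -⟩, ⟨-, hf, hfl⟩, ⟨-, hr, hrl⟩⟩ := h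
  obtain ⟨a, ha, hac⟩ := e.exists_factors_comp f
  have hp : p.top * J.longest⁻¹ = a.prod := by simp [he, ha]
  rw [hac, List.prod_append, ← hf] at hr hrl
  rw [← hf] at hfl
  rw [List.map_append, List.sum_append, ← hfl] at hrl
  rw [hp]
  -- The length of the composite is the sum over `a` plus `ℓ(q.top)`, and the sum over `a` is at
  -- least the length of its product.
  refine ⟨hr, le_antisymm (cs.length_mul_le _ _) ?_⟩
  rw [hrl]
  exact Nat.add_le_add_right (cs.length_prod_le_sum a) _

/-- When lengths add, the Demazure product is the ordinary product, so both cosets have the same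
top. -/
theorem eq_star (h : p.IsReducedComposition q r) : r = p.star q := by
  obtain ⟨h1, h2⟩ := h.length_mul_longest_inv_mul
  rw [← r.mk_top, ← (p.star q).mk_top, h1, top_star_eq_star_mul_longest_inv, star_eq_mul h2]

theorem length_top (h : p.IsReducedComposition q r) :
    cs.length r.top + cs.length J.longest = cs.length p.top + cs.length q.top := by
  obtain ⟨h1, h2⟩ := h.length_mul_longest_inv_mul
  have h3 := p.length_top_mul_longest_inv
  rw [h1]
  omega

end Coset.IsReducedComposition

end CoxeterSystem

theorem mainTheorem3 {B : Type*} {W : Type*} [Group W] {M : CoxeterMatrix B}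
    (cs : CoxeterSystem M W) (I J K L : cs.FinitarySubset)
    (q q' : CoxeterSystem.Coset I J) (hq : q'.lt q)
    (p : CoxeterSystem.Coset K I) (r : CoxeterSystem.Coset J L)
    (pq : CoxeterSystem.Coset K J) (pqr : CoxeterSystem.Coset K L)
    (hpq : p.IsReducedComposition q pq) (hpqr : pq.IsReducedComposition r pqr) :
    ((p.star q').star r).lt pqr := by
  obtain ⟨hle, hlt⟩ := CoxeterSystem.Coset.lt_iff_top.mp hq
  refine CoxeterSystem.Coset.lt_iff_top.mpr ⟨?_, ?_⟩
  · rw [hpqr.eq_star, hpq.eq_star]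
    simp only [CoxeterSystem.Coset.top_star]
    exact (hle.star_left _).star_right _
  · have h1 := hpq.length_top
    have h2 := hpqr.length_top
    have h3 := p.length_top_star_le q'
    have h4 := (p.star q').length_top_star_le r
    -- Both lengths are compared with sums of three tops minus `ℓ(w_I) + ℓ(w_J)`; these sums differ
    -- only in the tops of `q'` and `q`.
    omega
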